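/- A \emph{computer} is a partial recursive function $C:\{0,1\}^*\to\{0,1\}^*$; $\Xi$ is the set of all computers, $\otimes$ denotes concatenation of strings, and $\lambda$ is the empty string. For $C,D\in\Xi$ and $x\in\{0,1\}^*$, $C$ \emph{emulates} $D$ via $x$, written $C\xrightarrow{x}D$, if $C(x\otimes s)=D(s)$ for all $s\in\{0,1\}^*$ (both sides may be undefined); the unique such $D$ is denoted $(C\xrightarrow{x})$. Let $\Xi^U$ be the set of all computers that emulate every computer in $\Xi$ via some string. Let $\Phi\subset\Xi$. For $C\in\Phi$ let $T_C:=\{x\in\{0,1\}^*\mid (C\xrightarrow{x})\in\Phi\}$, and define path probabilities on $T_C$ by $p_C(\lambda)=1$ and, for each bit $b$ with $x\otimes b\in T_C$, $p_C(x\otimes b)=\frac12 p_C(x)$ if $x\otimes\bar b\in T_C$ and $p_C(x\otimes b)=p_C(x)$ otherwise, where $\bar b$ is the inverse bit. For $C,D\in\Phi$ and $n\ge 0$ put $\mu_C^{(n)}(D|\Phi)=\sum_{x\in\{0,1\}^n:\,C\xrightarrow{x}D}p_C(x)$. The set $\Phi$ is - \emph{branching} if for every $C\in\Phi$: $(C\xrightarrow{x\otimes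 y})\in\Phi$ implies $(C\xrightarrow{x})\in\Phi$ for all $x,y\in\{0,1\}^*$, and $(C\xrightarrow{x})\in\Phi$ for some $x\neq\lambda$; - \emph{irreducible} if for all $C,D\in\Phi$ there is $x$ with $C\xrightarrow{x}D$; - \emph{aperiodic} if for every $C\in\Phi$ the set $\{n\ge1\mid\mu_C^{(n)}(C|\Phi)>0\}$ is non-empty and has greatest common divisor $1$. The process of $\Phi$ is the Markov chain with state space $\Phi$ and transition matrix $(\mu_C^{(1)}(D|\Phi))_{C,D\in\Phi}$. It is \emph{positive recurrent} if $\Phi\neq\emptyset$ and, for every $C\in\Phi$, the chain started in $C$ returns to $C$ with probability one and with finite expected return time. For a computable permutation $\sigma$ of $\{0,1\}^*$, the \emph{output transformation} $\sigma$ maps a computer $C$ to the computer $\sigma\circ C$. A set $S$ of computable permutations of $\{0,1\}^*$ is \emph{cyclic} if it contains with each permutation its inverse, and if for every $s\in\{0,1\}^*$ the set $\{\sigma_1\circ\dots\circ\sigma_N(s)\mid N\geq 1,\ \sigma_1,\dots,\sigma_N\in S\}$ is infinite. \textbf{Theorem.} Let $\Phi\subset\Xi$ be branching, irreducible and aperiodic,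 and suppose that $\Phi$ is not the one-element set whose only member is the computer that halts on no input. If there is a cyclic set $S$ such that $\sigma\circ C\in\Phi$ for all $\sigma\in S$ and $C\in\Phi$, then the process of $\Phi$ is not positive recurrent. In particular, the process of $\Xi^U$ is not positive recurrent. -/

import Mathlib

open scoped ENNReal

noncomputable section

namespace Emulation

/-! ### Computers and emulation -/

/-- A computer is a partial recursive function on finite binary strings. -/
abbrev Computer : Type := {C : List Bool →. List Bool // Partrec C}

/-- The computer that halts on no input. -/
def Computer.nowhere : Computer := ⟨fun _ => Part.none, Partrec.none⟩

/-- `Emulates C x D`: the computer `C` emulates `D` via the string `x`. -/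
def Emulates (C : Computer) (x : List Bool) (D : Computer) : Prop :=
  ∀ s : List Bool, C.1 (x ++ s) = D.1 s

/-- The unique computer that `C` emulates via `x`, i.e. `s ↦ C (x ⊗ s)`. -/
def Computer.after (C : Computer) (x : List Bool) : Computer :=
  ⟨fun s => C.1 (x ++ s),
    C.2.comp (Primrec.list_append.comp (Primrec.const x) Primrec.id).to_comp⟩

theorem emulates_iff (C : Computer) (x : List Bool) (D : Computer) :
    Emulates C x D ↔ C.after x = D := by
  constructor
  · intro h
    exact Subtype.ext (funext h)
  · rintro rfl s
    rfl

/-- The set of the `Φ`-universal computers. -/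
def universalIn (Φ : Set Computer) : Set Computer :=
  {C | C ∈ Φ ∧ ∀ D ∈ Φ, ∃ x, Emulates C x D}

/-! ### The random walk on the tree of emulated computers -/

/-- `Φ` is branching. -/
def Branching (Φ : Set Computer) : Prop :=
  ∀ C ∈ Φ,
    (∀ x y : List Bool, C.after (x ++ y) ∈ Φ → C.after x ∈ Φ) ∧
    ∃ x : List Bool, x ≠ [] ∧ C.after x ∈ Φ

/-- The `Φ`-tree of `C`: all inputs that make `C` emulate a computer in `Φ`. -/
def tree (Φ : Set Computer) (C : Computer) : Set (List Bool) :=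
  {x | C.after x ∈ Φ}

open scoped Classical in
/-- Path probability of the string whose reversal is given (so that the last bit comes first):
appending the bit `b` to `x` costs a factor `1/2` if the sibling of the new node lies in the
tree too, and is forced otherwise. -/
def pathProbRev (T : Set (List Bool)) : List Bool → ℝ≥0∞
  | [] => 1
  | b :: r => if r.reverse ++ [!b] ∈ T then pathProbRev T r / 2 else pathProbRev T r

/-- Probability of arriving at the node `x ∈ T` on a random walk on the tree `T`. -/
def pathProb (T : Set (List Bool)) (x : List Bool) : ℝ≥0∞ := pathProbRev T x.reverse

open scoped Classical in
/-- The `n`-step computer probability of `D` from `C`, for the random walk on the `Φ`-tree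
of `C`; the sum runs over the strings `x` of length `n` via which `C` emulates `D`. -/
def stepProb (Φ : Set Computer) (n : ℕ) (C D : Computer) : ℝ≥0∞ :=
  ∑ x : Fin n → Bool,
    if Emulates C (List.ofFn x) D then pathProb (tree Φ C) (List.ofFn x) else 0

/-- The emulation matrix of `Φ`, indexed by the computers in `Φ`. -/
def emulationMatrix (Φ : Set Computer) : Matrix Φ Φ ℝ≥0∞ :=
  fun C D => stepProb Φ 1 C D

/-- `Φ` is irreducible: each of its computers emulates each of its computers. -/
def Irreducible (Φ : Set Computer) : Prop :=
  ∀ C ∈ Φ, ∀ D ∈ Φ, ∃ x, Emulates C x D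

/-- `d` is the (finite) period of `C`: the greatest common divisor of the positive integers `n`
with positive `n`-step return probability; there must be such an `n`. -/
def HasPeriod (Φ : Set Computer) (C : Computer) (d : ℕ) : Prop :=
  (∃ n : ℕ, 0 < n ∧ 0 < stepProb Φ n C C) ∧
  ∀ k : ℕ, k ∣ d ↔ ∀ n : ℕ, 0 < n → 0 < stepProb Φ n C C → k ∣ n

/-- `Φ` is aperiodic: all its computers have period one. -/
def Aperiodic (Φ : Set Computer) : Prop :=
  ∀ C ∈ Φ, HasPeriod Φ C 1

/-! ### Positive recurrence of Markov chains on a discrete state space -/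

open scoped Classical in
/-- Probability that the chain with transition matrix `P`, started in `i`, visits `j` at time `n`
for the first time after time `0`. -/
def firstPassage {ι : Type*} (P : Matrix ι ι ℝ≥0∞) (j : ι) : ℕ → ι → ℝ≥0∞
  | 0, _ => 0
  | 1, i => P i j
  | n + 2, i => ∑' k : ι, if k = j then 0 else P i k * firstPassage P j (n + 1) k

/-- The state `i` is positive recurrent: the chain started in `i` returns to `i` with
probability one, and the expected return time is finite. -/
def PositiveRecurrentState {ι : Type*} (P : Matrix ι ι ℝ≥0∞) (i : ι) : Prop :=
  ∑' n : ℕ, firstPassage P i n i = 1 ∧ ∑' n : ℕ, (n : ℝ≥0∞) * firstPassage P i n i < ∞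

/-- The Markov process of `Φ` is positive recurrent: its state space is not empty
and all states are positive recurrent. -/
def PositiveRecurrent (Φ : Set Computer) : Prop :=
  Φ.Nonempty ∧ ∀ C : Φ, PositiveRecurrentState (emulationMatrix Φ) C

/-! ### Output transformations -/

/-- A computable permutation of the set of finite binary strings. -/
abbrev ComputablePerm : Type := {σ : Equiv.Perm (List Bool) // Computable σ}

/-- The output transformation `C ↦ σ ∘ C`; it is undefined where `C` is. -/
def outputTransform (σ : ComputablePerm) (C : Computer) : Computer :=
  ⟨fun x => (C.1 x).map σ.1, C.2.map (σ.2.comp Computable.snd).to₂⟩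

/-- `Φ` is closed with respect to the transformation `T`. -/
def ClosedUnder (T : Computer → Computer) (Φ : Set Computer) : Prop :=
  T '' Φ ⊆ Φ

/-- `S` is cyclic: it contains with each permutation its inverse, and the finite compositions
of its elements map each string to infinitely many strings. -/
def IsCyclicSet (S : Set ComputablePerm) : Prop :=
  (∀ σ ∈ S, ∃ τ ∈ S, τ.1 = σ.1⁻¹) ∧
  ∀ s : List Bool,
    {t : List Bool | ∃ l : List ComputablePerm, l ≠ [] ∧ (∀ σ ∈ l, σ ∈ S) ∧
      (l.map fun σ => σ.1).prod s = t}.Infinite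

end Emulation

end

/-! Expected visits during an excursion from a positive recurrent state form a finite stationary
measure (`exists_isStationary`). On an irreducible chain, finite stationary measures of equal mass
coincide, so such a measure is invariant under every automorphism of the chain
(`IsStationary.comp_equiv`).

Emulation acts on inputs and output transformations act on outputs, so the two commute; with closure
under inverses, each `σ ∈ S` is an automorphism of the process (`emulationMatrix_outputEquiv`). If
some `C ∈ Φ` halts on `x` with output `s`, cyclicity of `S` yields computers with infinitely many
different outputs on `x`, all of the same positive mass as `C`. This contradicts finiteness. For the
universal computers, take `S` to be the transpositions of strings. -/

open scoped ENNReal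

namespace Emulation

/-! ### Stationary measures of irreducible Markov chains -/

section MarkovChain

variable {ι : Type*}

/-- `ν` is a stationary measure of the transition matrix `P`. -/
def IsStationary (P : Matrix ι ι ℝ≥0∞) (ν : ι → ℝ≥0∞) : Prop :=
  ∀ k, ∑' j, ν j * P j k = ν k

/-- Every state can be reached from every state through transitions of positive probability. -/
def IsIrreducibleChain (P : Matrix ι ι ℝ≥0∞) : Prop :=
  ∀ i j, Relation.ReflTransGen (fun a b => 0 < P a b) i j

open scoped Classical in
/-- Probability that the chain started in `i` is in `k` at time `n` without having returned
to `i` up to that time. -/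
noncomputable def tabooProb (P : Matrix ι ι ℝ≥0∞) (i : ι) : ℕ → ι → ℝ≥0∞
  | 0, k => if k = i then 1 else 0
  | n + 1, k => if k = i then 0 else ∑' j, tabooProb P i n j * P j k

theorem tsum_mul_tsum_mul (v g : ι → ℝ≥0∞) (P : Matrix ι ι ℝ≥0∞) :
    ∑' k, (∑' j, v j * P j k) * g k = ∑' j, v j * ∑' k, P j k * g k := by
  simp_rw [← ENNReal.tsum_mul_right, ← ENNReal.tsum_mul_left]
  rw [ENNReal.tsum_comm]
  simp_rw [mul_assoc]

theorem tsum_tsum_mul_of_stochastic {P : Matrix ι ι ℝ≥0∞} (hP : ∀ i, ∑' j, P i j = 1)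
    (v : ι → ℝ≥0∞) : ∑' k, ∑' j, v j * P j k = ∑' j, v j := by
  rw [ENNReal.tsum_comm]
  simp_rw [ENNReal.tsum_mul_left, hP, mul_one]

/-- A transition that avoids `i` may be counted as the last step of the taboo walk or as the first
step of the passage. -/
theorem tsum_tabooProb_succ_mul_firstPassage (P : Matrix ι ι ℝ≥0∞) (i : ι) (n m : ℕ) :
    ∑' k, tabooProb P i (n + 1) k * firstPassage P i (m + 1) k =
      ∑' k, tabooProb P i n k * firstPassage P i (m + 2) k := by
  classical
  have h := tsum_mul_tsum_mul (tabooProb P i n)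
    (fun k => if k = i then 0 else firstPassage P i (m + 1) k) P
  calc _ = _ := tsum_congr fun k => by
        by_cases hk : k = i <;> simp [tabooProb, hk]
    _ = _ := h
    _ = _ := tsum_congr fun j => by
        rw [firstPassage]
        congr 1
        exact tsum_congr fun k => by by_cases hk : k = i <;> simp [hk]

theorem tsum_tabooProb_mul_firstPassage (P : Matrix ι ι ℝ≥0∞) (i : ι) (n m : ℕ) :
    ∑' k, tabooProb P i n k * firstPassage P i (m + 1) k = firstPassage P i (n + m + 1) i := by
  classical
  induction n generalizing m with
  | zero =>
    rw [tsum_eq_single i (fun k hk => by simp [tabooProb, hk])]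
    simp [tabooProb]
  | succ n ih =>
    rw [tsum_tabooProb_succ_mul_firstPassage, ih (m + 1)]
    congr 1
    omega

theorem tsum_tabooProb_mul_self (P : Matrix ι ι ℝ≥0∞) (i : ι) (n : ℕ) :
    ∑' k, tabooProb P i n k * P k i = firstPassage P i (n + 1) i :=
  tsum_tabooProb_mul_firstPassage P i n 0

/-- The mass surviving to time `n` either hits `i` at the next step or survives again. -/
theorem tsum_tabooProb_succ_add {P : Matrix ι ι ℝ≥0∞} (hP : ∀ i, ∑' j, P i j = 1)
    (i : ι) (n : ℕ) :
    ∑' k, tabooProb P i (n + 1) k + firstPassage P i (n + 1) i = ∑' k, tabooProb P i n k := by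
  classical
  rw [← tsum_tsum_mul_of_stochastic hP (tabooProb P i n), ← tsum_tabooProb_mul_self,
    ← tsum_ite_eq i (fun _ => ∑' k, tabooProb P i n k * P k i), ← ENNReal.tsum_add]
  refine tsum_congr fun k => ?_
  by_cases hk : k = i <;> simp [tabooProb, hk]

theorem tsum_tabooProb {P : Matrix ι ι ℝ≥0∞} (hP : ∀ i, ∑' j, P i j = 1) {i : ι}
    (hi : ∑' n, firstPassage P i n i = 1) (n : ℕ) :
    ∑' k, tabooProb P i n k = ∑' m, if n < m then firstPassage P i m i else 0 := by
  classical
  induction n with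
  | zero =>
    rw [tsum_eq_single i (fun k hk => by simp [tabooProb, hk])]
    simp only [tabooProb, if_true, ← hi]
    refine tsum_congr fun m => ?_
    cases m <;> simp [firstPassage]
  | succ n ih =>
    have hfin : firstPassage P i (n + 1) i ≠ ∞ :=
      ne_top_of_le_ne_top ENNReal.one_ne_top (hi ▸ ENNReal.le_tsum (n + 1))
    rw [← ENNReal.add_left_inj hfin, tsum_tabooProb_succ_add hP, ih]
    rw [← tsum_ite_eq (n + 1) (fun _ => firstPassage P i (n + 1) i), ← ENNReal.tsum_add]
    refine tsum_congr fun m => ?_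
    rcases lt_trichotomy m (n + 1) with h | rfl | h
    · simp [show ¬ n < m by omega, show ¬ n + 1 < m by omega, h.ne]
    · simp
    · simp [show n < m by omega, h, h.ne']

/-- A positive recurrent state yields a finite stationary measure: the expected number of visits
during an excursion. -/
theorem exists_isStationary {P : Matrix ι ι ℝ≥0∞} (hP : ∀ i, ∑' j, P i j = 1) {i : ι}
    (hi : PositiveRecurrentState P i) :
    ∃ ν : ι → ℝ≥0∞, IsStationary P ν ∧ ∑' k, ν k ≠ ∞ ∧ ν i ≠ 0 := by
  classical
  have hvi : ∑' n, tabooProb P i n i = 1 := by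
    rw [tsum_eq_single 0 (fun n hn => by
      obtain ⟨n, rfl⟩ := Nat.exists_eq_succ_of_ne_zero hn
      simp [tabooProb])]
    simp [tabooProb]
  refine ⟨fun k => ∑' n, tabooProb P i n k, fun k => ?_, ?_, by simp [hvi]⟩
  · simp_rw [← ENNReal.tsum_mul_right]
    rw [ENNReal.tsum_comm]
    -- At `i`, stationarity says that return is certain. Elsewhere it is a shift of time by one, the
    -- term at time zero being zero.
    by_cases hk : k = i
    · subst hk
      rw [hvi, ← hi.1, tsum_eq_zero_add' (f := fun n => firstPassage P k n k) ENNReal.summable]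
      simp_rw [tsum_tabooProb_mul_self]
      simp [firstPassage]
    · rw [tsum_eq_zero_add' (f := fun n => tabooProb P i n k) ENNReal.summable]
      simp [tabooProb, hk]
  · rw [ENNReal.tsum_comm]
    simp_rw [tsum_tabooProb hP hi.1]
    -- Tail-sum formula: the tails of the return time add up to its expectation.
    rw [ENNReal.tsum_comm]
    refine ne_of_eq_of_ne (tsum_congr fun m => ?_) hi.2.ne
    rw [tsum_eq_sum (s := Finset.range m) (fun n hn => if_neg (by simpa using hn)),
      Finset.sum_congr rfl (fun n hn => if_pos (Finset.mem_range.1 hn))]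
    simp

theorem IsStationary.ne_zero {P : Matrix ι ι ℝ≥0∞} (hirr : IsIrreducibleChain P)
    {ν : ι → ℝ≥0∞} (hν : IsStationary P ν) {i : ι} (hi : ν i ≠ 0) (j : ι) : ν j ≠ 0 := by
  induction hirr i j with
  | refl => exact hi
  | @tail b c _ hbc ih =>
    intro hc
    rw [← hν c, ENNReal.tsum_eq_zero] at hc
    exact (mul_ne_zero ih hbc.ne') (hc b)

theorem eq_of_le_of_tsum_eq {f g : ι → ℝ≥0∞} (h : f ≤ g) (hg : ∑' k, g k ≠ ∞)
    (hfg : ∑' k, f k = ∑' k, g k) : f = g := by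
  funext k
  refine (h k).eq_of_not_lt fun hk => ?_
  exact (ENNReal.tsum_lt_tsum (hfg ▸ hg) h hk).ne hfg

/-- Two finite stationary measures of the same mass on an irreducible chain are comparable. -/
theorem IsStationary.le_of_tsum_eq {P : Matrix ι ι ℝ≥0∞} (hP : ∀ i, ∑' j, P i j = 1)
    (hirr : IsIrreducibleChain P) {ν ρ : ι → ℝ≥0∞} (hν : IsStationary P ν)
    (hρ : IsStationary P ρ) (hfin : ∑' k, ν k ≠ ∞) (hmass : ∑' k, ν k = ∑' k, ρ k) :
    ν ≤ ρ := by
  have hηfin : ∑' k, min (ν k) (ρ k) ≠ ∞ :=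
    ne_top_of_le_ne_top hfin (ENNReal.tsum_le_tsum fun k => min_le_left _ _)
  -- One step of the chain maps the minimum below both `ν` and `ρ`, hence below itself; as total
  -- mass is preserved and finite, equality holds.
  have hη : IsStationary P fun k => min (ν k) (ρ k) := by
    refine congrFun (eq_of_le_of_tsum_eq (fun k => le_min ?_ ?_) hηfin
      (tsum_tsum_mul_of_stochastic hP _))
    · exact (ENNReal.tsum_le_tsum fun j => mul_le_mul_left (min_le_left _ _) _).trans_eq (hν k)
    · exact (ENNReal.tsum_le_tsum fun j => mul_le_mul_left (min_le_right _ _) _).trans_eq (hρ k)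
  have hpt (k : ι) : min (ν k) (ρ k) ≠ ∞ :=
    ne_top_of_le_ne_top hηfin (ENNReal.le_tsum (f := fun k => min (ν k) (ρ k)) k)
  have hα : IsStationary P fun k => ν k - min (ν k) (ρ k) := by
    intro k
    refine (ENNReal.add_left_inj (hpt k)).1 ?_
    rw [tsub_add_cancel_of_le (min_le_left _ _)]
    have hηk : ∑' j, min (ν j) (ρ j) * P j k = min (ν k) (ρ k) := hη k
    rw [← hηk, ← ENNReal.tsum_add, ← hν k]
    refine tsum_congr fun j => ?_
    rw [← add_mul, tsub_add_cancel_of_le (min_le_left _ _)]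
  intro i
  by_contra hi
  -- The stationary excess of `ν` over the minimum is nonzero at `i`, so by irreducibility it is
  -- nonzero everywhere, against equal masses.
  have hlt (j : ι) : ρ j < ν j := by
    by_contra hj
    refine hα.ne_zero hirr (i := i) ?_ j (by simp [not_lt.1 hj])
    rw [min_eq_right (not_le.1 hi).le]
    exact (tsub_pos_of_lt (not_le.1 hi)).ne'
  exact (ENNReal.tsum_lt_tsum (hmass ▸ hfin) (fun j => (hlt j).le) (hlt i)).ne hmass.symm

/-- A finite stationary measure of an irreducible chain is invariant under the symmetries of
the chain. -/
theorem IsStationary.comp_equiv {P : Matrix ι ι ℝ≥0∞} (hP : ∀ i, ∑' j, P i j = 1)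
    (hirr : IsIrreducibleChain P) {ν : ι → ℝ≥0∞} (hν : IsStationary P ν)
    (hfin : ∑' k, ν k ≠ ∞) (e : ι ≃ ι) (he : ∀ i j, P (e i) (e j) = P i j) (i : ι) :
    ν (e i) = ν i := by
  have hs : IsStationary P (ν ∘ e) := by
    intro k
    rw [Function.comp_apply, ← hν (e k), ← e.tsum_eq fun j => ν j * P j (e k)]
    simp [he]
  have hm : ∑' k, (ν ∘ e) k = ∑' k, ν k := e.tsum_eq ν
  exact le_antisymm (hs.le_of_tsum_eq hP hirr hν (hm ▸ hfin) hm i)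
    (hν.le_of_tsum_eq hP hirr hs hfin hm.symm i)

end MarkovChain

/-! ### The emulation process and its symmetries -/

section Computers

theorem Computer.after_nil (C : Computer) : C.after [] = C := rfl

theorem Computer.after_after (C : Computer) (x y : List Bool) :
    (C.after x).after y = C.after (x ++ y) :=
  Subtype.ext (funext fun s => by simp [Computer.after])

theorem outputTransform_after (σ : ComputablePerm) (C : Computer) (x : List Bool) :
    (outputTransform σ C).after x = outputTransform σ (C.after x) := rfl

theorem outputTransform_outputTransform_of_eq_inv {σ τ : ComputablePerm} (h : τ.1 = σ.1⁻¹)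
    (C : Computer) : outputTransform τ (outputTransform σ C) = C := by
  refine Subtype.ext (funext fun s => ?_)
  simp only [outputTransform, Part.map_map, h]
  convert Part.map_id' (f := ⇑σ.1⁻¹ ∘ ⇑σ.1) (fun a => σ.1.symm_apply_apply a) (C.1 s)

open scoped Classical in
theorem emulationMatrix_eq {Φ : Set Computer} (C D : Φ) :
    emulationMatrix Φ C D =
      (if C.1.after [true] = D.1 then pathProb (tree Φ C) [true] else 0) +
        if C.1.after [false] = D.1 then pathProb (tree Φ C) [false] else 0 := by
  classical
  rw [emulationMatrix, stepProb, ← (Equiv.funUnique (Fin 1) Bool).symm.sum_comp]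
  simp [emulates_iff]

theorem pathProb_singleton_pos (T : Set (List Bool)) (b : Bool) : 0 < pathProb T [b] := by
  simp only [pathProb, List.reverse_singleton, pathProbRev]
  split_ifs <;> simp

theorem emulationMatrix_pos {Φ : Set Computer} (C D : Φ) (b : Bool) (h : C.1.after [b] = D.1) :
    0 < emulationMatrix Φ C D := by
  rw [emulationMatrix_eq]
  cases b
  · exact (pathProb_singleton_pos (tree Φ C) _).trans_le (by rw [if_pos h]; exact le_add_self)
  · exact (pathProb_singleton_pos (tree Φ C) _).trans_le (by rw [if_pos h]; exact le_self_add)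

open scoped Classical in
theorem tsum_ite_eq_coe {Φ : Set Computer} (C : Computer) (p : ℝ≥0∞) :
    ∑' D : Φ, (if C = D.1 then p else 0) = if C ∈ Φ then p else 0 := by
  split_ifs with h
  · rw [tsum_eq_single ⟨C, h⟩ (fun D hD => if_neg fun e => hD (Subtype.ext e.symm))]
    simp
  · exact ENNReal.tsum_eq_zero.2 fun D => if_neg fun e => h (by rw [e]; exact D.2)

/-- Branching puts at least one child of the root in the tree: two children get one half each, an
only child gets everything. -/
theorem tsum_emulationMatrix {Φ : Set Computer} (hΦ : Branching Φ) (C : Φ) :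
    ∑' D, emulationMatrix Φ C D = 1 := by
  classical
  obtain ⟨b, hb⟩ : ∃ b, C.1.after [b] ∈ Φ := by
    obtain ⟨hpre, x, hx, hxΦ⟩ := hΦ C.1 C.2
    obtain ⟨b, y, rfl⟩ := List.exists_cons_of_ne_nil hx
    exact ⟨b, hpre [b] y hxΦ⟩
  simp_rw [emulationMatrix_eq]
  rw [ENNReal.tsum_add]
  rw [tsum_ite_eq_coe, tsum_ite_eq_coe]
  cases b
  · by_cases h : C.1.after [true] ∈ Φ <;>
      simp [hb, h, pathProb, pathProbRev, tree, ENNReal.inv_two_add_inv_two]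
  · by_cases h : C.1.after [false] ∈ Φ <;>
      simp [hb, h, pathProb, pathProbRev, tree, ENNReal.inv_two_add_inv_two]

/-- Reading an emulating string bit by bit gives a path that stays in `Φ`, because the tree is
closed under prefixes. -/
theorem isIrreducibleChain_emulationMatrix {Φ : Set Computer} (hΦ : Branching Φ)
    (hirr : Irreducible Φ) : IsIrreducibleChain (emulationMatrix Φ) := by
  rintro ⟨C, hC⟩ ⟨D, hD⟩
  obtain ⟨x, hx⟩ := hirr C hC D hD
  rw [emulates_iff] at hx
  induction x generalizing C with
  | nil =>
    obtain rfl : C = D := hx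
    exact .refl
  | cons b x ih =>
    have hb : C.after [b] ∈ Φ := (hΦ C hC).1 [b] x (by simpa [hx] using hD)
    refine .head (emulationMatrix_pos ⟨C, hC⟩ ⟨C.after [b], hb⟩ b rfl) (ih _ hb ?_)
    rw [Computer.after_after]
    exact hx

/-- An output transformation under which, along with its inverse, `Φ` is closed, as a
permutation of `Φ`. -/
def outputEquiv {Φ : Set Computer} {σ τ : ComputablePerm} (h : τ.1 = σ.1⁻¹)
    (hσ : ClosedUnder (outputTransform σ) Φ) (hτ : ClosedUnder (outputTransform τ) Φ) :
    Φ ≃ Φ where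
  toFun C := ⟨outputTransform σ C, hσ ⟨C, C.2, rfl⟩⟩
  invFun C := ⟨outputTransform τ C, hτ ⟨C, C.2, rfl⟩⟩
  left_inv C := Subtype.ext (outputTransform_outputTransform_of_eq_inv h C.1)
  right_inv C := Subtype.ext (outputTransform_outputTransform_of_eq_inv (by simp [h]) C.1)

theorem emulationMatrix_outputEquiv {Φ : Set Computer} {σ τ : ComputablePerm} (h : τ.1 = σ.1⁻¹)
    (hσ : ClosedUnder (outputTransform σ) Φ) (hτ : ClosedUnder (outputTransform τ) Φ)
    (C D : Φ) :
    emulationMatrix Φ (outputEquiv h hσ hτ C) (outputEquiv h hσ hτ D) =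
      emulationMatrix Φ C D := by
  classical
  have htree : tree Φ (outputTransform σ C) = tree Φ C := by
    ext x
    simp only [tree, Set.mem_ofPred_eq, outputTransform_after]
    refine ⟨fun hx => ?_, fun hx => hσ ⟨_, hx, rfl⟩⟩
    rw [← outputTransform_outputTransform_of_eq_inv h (C.1.after x)]
    exact hτ ⟨_, hx, rfl⟩
  have hinj (x : List Bool) :
      outputTransform σ (C.1.after x) = outputTransform σ D ↔ C.1.after x = D.1 :=
    ⟨fun e => by
      rw [← outputTransform_outputTransform_of_eq_inv h (C.1.after x), e,
        outputTransform_outputTransform_of_eq_inv h], fun e => by rw [e]⟩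
  simp only [emulationMatrix_eq, outputEquiv, Equiv.coe_fn_mk, outputTransform_after, htree]
  congr 1
  · exact if_congr (hinj _) rfl rfl
  · exact if_congr (hinj _) rfl rfl

theorem exists_mem_dom_of_ne_nowhere {C : Computer} (hC : C ≠ Computer.nowhere) :
    ∃ x s, s ∈ C.1 x := by
  by_contra! h
  exact hC (Subtype.ext (funext fun x => Part.eq_none_iff.2 (h x)))

theorem not_positiveRecurrent_of_isCyclicSet {Φ : Set Computer} (hΦ : Branching Φ)
    (hirr : Irreducible Φ) (hne : Φ ≠ {Computer.nowhere}) {S : Set ComputablePerm}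
    (hS : IsCyclicSet S) (hclosed : ∀ σ ∈ S, ClosedUnder (outputTransform σ) Φ) :
    ¬ PositiveRecurrent Φ := by
  rintro ⟨hnonempty, hrec⟩
  obtain ⟨C, hC, hCne⟩ : ∃ C ∈ Φ, C ≠ Computer.nowhere := by
    by_contra! h
    exact hne (Set.eq_singleton_iff_nonempty_unique_mem.2 ⟨hnonempty, h⟩)
  obtain ⟨x, s, hs⟩ := exists_mem_dom_of_ne_nowhere hCne
  have hP := tsum_emulationMatrix hΦ
  have hchain := isIrreducibleChain_emulationMatrix hΦ hirr
  obtain ⟨ν, hν, hfin, hν0⟩ := exists_isStationary hP (hrec ⟨C, hC⟩)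
  -- Applying the permutations of `l` to `C` keeps its mass and moves its output on `x` along the
  -- orbit of `s`.
  have horbit (l : List ComputablePerm) (hl : ∀ σ ∈ l, σ ∈ S) :
      ∃ D : Φ, ν D = ν ⟨C, hC⟩ ∧ (l.map fun σ => σ.1).prod s ∈ D.1.1 x := by
    induction l with
    | nil => exact ⟨⟨C, hC⟩, rfl, hs⟩
    | cons σ l ih =>
      obtain ⟨D, hD, hDx⟩ := ih fun τ hτ => hl τ (List.mem_cons_of_mem _ hτ)
      have hσ : σ ∈ S := hl σ List.mem_cons_self
      obtain ⟨τ, hτ, hστ⟩ := hS.1 σ hσ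
      refine ⟨outputEquiv hστ (hclosed σ hσ) (hclosed τ hτ) D, ?_, ?_⟩
      · rw [hν.comp_equiv hP hchain hfin _ (emulationMatrix_outputEquiv hστ _ _), hD]
      · rw [List.map_cons, List.prod_cons, Equiv.Perm.mul_apply]
        exact Part.mem_map _ hDx
  have hfinite : {D : Φ | ν ⟨C, hC⟩ ≤ ν D}.Finite :=
    ENNReal.finite_const_le_of_tsum_ne_top hfin hν0
  -- Finitely many computers have mass at least that of `C`, so they have finitely many outputs on
  -- `x`; these would exhaust the infinite orbit of `s`.
  refine hS.2 s ((hfinite.image fun D => D.1.1 x).preimage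
    (Set.injOn_of_injective Part.some_injective) |>.subset ?_)
  rintro t ⟨l, -, hl, rfl⟩
  obtain ⟨D, hD, hDx⟩ := horbit l hl
  exact ⟨D, hD.ge, Part.eq_some_iff.2 hDx⟩

end Computers

/-! ### The universal computers -/

section Universal

theorem computable_swap (a b : List Bool) : Computable (Equiv.swap a b) := by
  have h (c : List Bool) : PrimrecPred fun x : List Bool => x = c :=
    Primrec.eq.comp Primrec.id (Primrec.const c)
  exact (Primrec.ite (h a) (Primrec.const b)
    (Primrec.ite (h b) (Primrec.const a) Primrec.id)).to_comp

/-- The transpositions of strings, as computable permutations. -/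
def swaps : Set ComputablePerm :=
  {σ | ∃ a b, σ = ⟨Equiv.swap a b, computable_swap a b⟩}

theorem isCyclicSet_swaps : IsCyclicSet swaps := by
  refine ⟨?_, fun s => ?_⟩
  · rintro _ ⟨a, b, rfl⟩
    exact ⟨_, ⟨a, b, rfl⟩, (Equiv.swap_inv a b).symm⟩
  · refine Set.infinite_univ.mono fun t _ => ?_
    exact ⟨[⟨Equiv.swap s t, computable_swap s t⟩], by simp, by simp [swaps], by simp⟩

theorem mem_universalIn_univ {C : Computer} :
    C ∈ universalIn Set.univ ↔ ∀ D, ∃ x, C.after x = D := by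
  simp [universalIn, emulates_iff]

theorem closedUnder_outputTransform_universalIn {σ : ComputablePerm} (hσ : σ ∈ swaps) :
    ClosedUnder (outputTransform σ) (universalIn Set.univ) := by
  rintro _ ⟨C, hC, rfl⟩
  rw [mem_universalIn_univ] at hC ⊢
  intro D
  obtain ⟨a, b, rfl⟩ := hσ
  -- The transposition is its own inverse, so it suffices that `C` emulates the transformed `D`.
  obtain ⟨x, hx⟩ := hC (outputTransform ⟨Equiv.swap a b, computable_swap a b⟩ D)
  exact ⟨x, by rw [outputTransform_after, hx,
    outputTransform_outputTransform_of_eq_inv (Equiv.swap_inv a b).symm]⟩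

theorem nowhere_notMem_universalIn : Computer.nowhere ∉ universalIn Set.univ := by
  rw [mem_universalIn_univ]
  intro h
  obtain ⟨x, hx⟩ := h ⟨fun s => Part.some s, Partrec.some⟩
  have := congrFun (congrArg Subtype.val hx) []
  exact Part.some_ne_none _ this.symm

theorem branching_universalIn : Branching (universalIn Set.univ) := by
  intro C hC
  refine ⟨fun x y hxy => ?_, ?_⟩
  · rw [mem_universalIn_univ] at hxy ⊢
    intro D
    obtain ⟨z, hz⟩ := hxy D
    exact ⟨y ++ z, by rw [← hz, Computer.after_after, Computer.after_after, List.append_assoc]⟩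
  · obtain ⟨x, s, hs⟩ := exists_mem_dom_of_ne_nowhere
      fun h : C = Computer.nowhere => nowhere_notMem_universalIn (h ▸ hC)
    -- The string must be nonempty, so the target is a universal computer other than `C`: changing
    -- the output `s` on `x` guarantees this.
    set σ : ComputablePerm := ⟨Equiv.swap s (true :: s), computable_swap _ _⟩ with hσ
    obtain ⟨y, hy⟩ := mem_universalIn_univ.1 hC (outputTransform σ C)
    refine ⟨y, ?_, hy ▸ closedUnder_outputTransform_universalIn ⟨_, _, hσ⟩ ⟨C, hC, rfl⟩⟩
    rintro rfl
    have h : σ.1 s ∈ C.1 x := by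
      rw [← C.after_nil, hy]
      exact Part.mem_map _ hs
    have := Part.mem_unique hs h
    simp [hσ] at this

theorem irreducible_universalIn : Irreducible (universalIn Set.univ) :=
  fun _ hC D _ => hC.2 D trivial

theorem not_positiveRecurrent_universalIn : ¬ PositiveRecurrent (universalIn Set.univ) :=
  not_positiveRecurrent_of_isCyclicSet branching_universalIn irreducible_universalIn
    (fun h => nowhere_notMem_universalIn (h ▸ rfl)) isCyclicSet_swaps
    fun _ => closedUnder_outputTransform_universalIn

end Universal

end Emulation

theorem theorem4p7 :
    (∀ Φ : Set Emulation.Computer,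
      Emulation.Branching Φ → Emulation.Irreducible Φ → Emulation.Aperiodic Φ →
      Φ ≠ {Emulation.Computer.nowhere} →
      ∀ S : Set Emulation.ComputablePerm, Emulation.IsCyclicSet S →
        (∀ σ ∈ S, Emulation.ClosedUnder (Emulation.outputTransform σ) Φ) →
        ¬ Emulation.PositiveRecurrent Φ) ∧
    ¬ Emulation.PositiveRecurrent (Emulation.universalIn Set.univ) :=
  ⟨fun _ hΦ hirr _ hne _ hS hclosed =>
    Emulation.not_positiveRecurrent_of_isCyclicSet hΦ hirr hne hS hclosed,
    Emulation.not_positiveRecurrent_universalIn⟩
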